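/- Let $k\ge 3$ be an odd integer and let $n\ge 1$ be an integer. For $H\in\mathbb N$ let $G_n^k(H)$ be the number of distinct subfields of $\mathbb R$ of the form $\mathbb Q(\sqrt[k]{a_1},\dots,\sqrt[k]{a_n})$, where $a_1,\dots,a_n$ are integers in $[1,H]$, $\sqrt[k]{a_i}$ denotes the real $k$-th root, and $[\mathbb Q(\sqrt[k]{a_1},\dots,\sqrt[k]{a_n}):\mathbb Q]=k^n$. Then, for fixed $k$ and $n$, as $H\to\infty$, $$G_n^k(H)=\left(\frac{1}{n!\,\zeta(k)^n}+O\!\left(\exp\!\left(-(1+o(1))\sqrt{\tfrac12(\log H)(\log\log H)}\right)\right)\right)H^n,$$ where $\zeta$ is the Riemann zeta function, and the implied constant and the rate of convergence of the $o(1)$ term may depend on $k$ and $n$. -/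

import Mathlib

open Filter Asymptotics Topology
open scoped Nat

/-- The real radical extension `ℚ(a₁^{1/k}, …, aₙ^{1/k})`, as a subfield of `ℝ`, where
`aᵢ^{1/k}` is the real (nonnegative) `k`-th root of the natural number `aᵢ`. -/
noncomputable def radicalField (k : ℕ) {n : ℕ} (a : Fin n → ℕ) : IntermediateField ℚ ℝ :=
  IntermediateField.adjoin ℚ (Set.range fun i => (a i : ℝ) ^ ((1 : ℝ) / (k : ℝ)))

/-- The set of the fields `ℚ(a₁^{1/k}, …, aₙ^{1/k})` of degree exactly `k ^ n` over `ℚ`, with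
`a ∈ ℕⁿ ∩ [1, H]ⁿ`.  It is a set of subfields of `ℝ`, so coinciding fields count once. -/
def maxDegreeFields (k n H : ℕ) : Set (IntermediateField ℚ ℝ) :=
  {K | ∃ a : Fin n → ℕ, (∀ i, 1 ≤ a i ∧ a i ≤ H) ∧ radicalField k a = K ∧
    Module.finrank ℚ K = k ^ n}

/-- There are finitely many such fields, so that `Set.ncard` below is their honest number. -/
theorem maxDegreeFields_finite (k n H : ℕ) : (maxDegreeFields k n H).Finite := by
  have hfin : (Set.univ.pi fun _ : Fin n => Set.Icc 1 H).Finite :=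
    Set.Finite.pi fun _ => Set.finite_Icc 1 H
  refine (hfin.image (radicalField k)).subset ?_
  rintro K ⟨a, ha, hK, -⟩
  exact ⟨a, fun i _ => ha i, hK⟩

/-- The number of distinct fields `ℚ(a₁^{1/k}, …, aₙ^{1/k})` of degree `k ^ n` with
`a ∈ ℕⁿ ∩ [1, H]ⁿ`. -/
noncomputable def maxDegreeCount (k n H : ℕ) : ℕ :=
  (maxDegreeFields k n H).ncard

/-! Removing the largest `k`-th power from each `a i` multiplies its root by a positive integer, so
every field counted is generated by the roots of `n` power free integers up to `H`, distinct because
the degree is `k ^ n`. With `q` power free integers there are at most `q.choose n` fields.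

For the lower bound, a trace argument shows that a positive radical lying in a field of real
radicals is a rational multiple of a monomial in the generators (`exists_eq_rat_mul_radMon`), and
that the degree is full once the generators are independent modulo `k`-th powers
(`finrank_adjoin_radicals_eq`). So an `n`-set `A` of power free integers other than `1` is recovered
from its field unless some `b ∉ A` is a nontrivial product of powers of elements of `A` modulo
`k`-th powers (`HasExtraRadical`).

Such a relation constrains the valuations of `(a₁, …, aₙ, b)` at every prime. Rankin's method with
suitable weights (`exists_weights`) bounds the exceptional sets by `O(H ^ (n - 1/10))`; oddness of
`k` enters here. Since `q = H / ζ(k) + O(√H)`, the total error saves a power of `H`, which is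
stronger than the stated bound. -/

/-! ### Traces of real radicals -/

-- All complex conjugates of `x` are roots of `X ^ k - q`, hence have modulus `x`. The constant
-- coefficient of the minimal polynomial is their product up to sign.
open Polynomial in
theorem exists_rat_eq_pow_natDegree_minpoly {x : ℝ} (hx : 0 < x) {k : ℕ} (hk : 0 < k) {q : ℚ}
    (h : x ^ k = (q : ℝ)) : ∃ c : ℚ, x ^ (minpoly ℚ x).natDegree = (c : ℝ) := by
  have hint : IsIntegral ℚ x := by
    refine ⟨X ^ k - C q, monic_X_pow_sub_C q hk.ne', ?_⟩
    simp [h]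
  have hmonic := minpoly.monic hint
  have hdvd : minpoly ℚ x ∣ X ^ k - C q := minpoly.dvd _ _ (by simp [h])
  set P := (minpoly ℚ x).map (algebraMap ℚ ℂ) with hP
  have hPm : P.Monic := hmonic.map _
  have hsplit : P.Splits := IsAlgClosed.splits P
  have h0 := hsplit.coeff_zero_eq_prod_roots_of_monic hPm
  have hroot : ∀ z ∈ P.roots, ‖z‖ = x := by
    intro z hz
    have hz0 : P.IsRoot z := isRoot_of_mem_roots hz
    have hdvd' : P ∣ X ^ k - C (q : ℂ) := by
      have := Polynomial.map_dvd (algebraMap ℚ ℂ) hdvd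
      simpa using this
    have hz1 := hz0.dvd hdvd'
    have hz2 : z ^ k = (q : ℂ) := by
      simpa [IsRoot, sub_eq_zero] using hz1
    have hz3 : ‖z‖ ^ k = x ^ k := by
      rw [← norm_pow, hz2, h, Complex.norm_ratCast, ← h]
      exact abs_of_pos (by positivity)
    exact (pow_left_inj₀ (norm_nonneg z) hx.le hk.ne').1 hz3
  refine ⟨|(minpoly ℚ x).coeff 0|, ?_⟩
  have h1 : ‖P.coeff 0‖ = x ^ (minpoly ℚ x).natDegree := by
    rw [h0, norm_mul, norm_pow, norm_neg, norm_one, one_pow, one_mul]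
    have h2 : ‖P.roots.prod‖ = (P.roots.map (fun z => ‖z‖)).prod :=
      (Multiset.prod_hom P.roots (normHom : ℂ →*₀ ℝ)).symm
    rw [h2, Multiset.map_congr rfl hroot, Multiset.map_const', Multiset.prod_replicate,
      ← hsplit.natDegree_eq_card_roots, hP, natDegree_map]
  rw [← h1, hP, coeff_map]
  simp

-- With `d` the degree of `x`, the minimal polynomial is `X ^ d - c`. As `x` is irrational, `d ≥ 2`,
-- so the coefficient of `X ^ (d - 1)` vanishes.
open Polynomial in
theorem trace_eq_zero_of_pow_eq_rat {K : IntermediateField ℚ ℝ} [FiniteDimensional ℚ K] {x : K}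
    (hx : 0 < (x : ℝ)) {k : ℕ} (hk : 0 < k) {q : ℚ} (h : (x : ℝ) ^ k = (q : ℝ))
    (hirr : ∀ c : ℚ, (x : ℝ) ≠ c) : Algebra.trace ℚ K x = 0 := by
  obtain ⟨c, hc⟩ := exists_rat_eq_pow_natDegree_minpoly hx hk h
  have hint : IsIntegral ℚ (x : ℝ) := by
    refine ⟨X ^ k - C q, monic_X_pow_sub_C q hk.ne', ?_⟩
    simp [h]
  have hd : 0 < (minpoly ℚ (x : ℝ)).natDegree := minpoly.natDegree_pos hint
  have hmin : X ^ (minpoly ℚ (x : ℝ)).natDegree - C c = minpoly ℚ (x : ℝ) := by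
    refine eq_of_monic_of_dvd_of_natDegree_le (minpoly.monic hint)
      (monic_X_pow_sub_C c hd.ne') (minpoly.dvd _ _ (by simp [hc])) ?_
    rw [natDegree_X_pow_sub_C]
  have hd1 : (minpoly ℚ (x : ℝ)).natDegree ≠ 1 := by
    intro h1
    exact hirr c (by simpa [h1] using hc)
  have hmineq : minpoly ℚ x = minpoly ℚ (x : ℝ) :=
    (minpoly.algebraMap_eq (algebraMap K ℝ).injective x).symm
  rw [trace_eq_finrank_mul_minpoly_nextCoeff, hmineq]
  have hnext : (minpoly ℚ (x : ℝ)).nextCoeff = 0 := by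
    rw [nextCoeff_of_natDegree_pos hd]
    nth_rw 1 [← hmin]
    rw [coeff_sub, coeff_X_pow, coeff_C, if_neg (by omega), if_neg (by omega), sub_zero]
  rw [hnext]
  simp

/-! ### Fields generated by real radicals -/

section Radicals

variable {ι : Type*} [Fintype ι]

/-- The monomial `∏ xᵢ ^ eᵢ`. -/
noncomputable def radMon (x : ι → ℝ) (e : ι → ℕ) : ℝ := ∏ i, x i ^ e i

theorem radMon_add (x : ι → ℝ) (e f : ι → ℕ) : radMon x (e + f) = radMon x e * radMon x f := by
  simp [radMon, pow_add, Finset.prod_mul_distrib]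

theorem radMon_smul (x : ι → ℝ) (m : ℕ) (e : ι → ℕ) :
    radMon x (fun i => m * e i) = radMon x e ^ m := by
  simp [radMon, ← Finset.prod_pow, mul_comm m, pow_mul]

theorem radMon_pos {x : ι → ℝ} (hx : ∀ i, 0 < x i) (e : ι → ℕ) : 0 < radMon x e :=
  Finset.prod_pos fun i _ => pow_pos (hx i) _

theorem radMon_pow {x : ι → ℝ} {a : ι → ℕ} {k : ℕ} (h : ∀ i, x i ^ k = a i) (e : ι → ℕ) :
    radMon x e ^ k = ((∏ i, a i ^ e i : ℕ) : ℝ) := by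
  push_cast
  rw [radMon, ← Finset.prod_pow]
  refine Finset.prod_congr rfl fun i _ => ?_
  rw [← h i, ← pow_mul, ← pow_mul, mul_comm]

theorem radMon_mem_adjoin (x : ι → ℝ) (e : ι → ℕ) :
    radMon x e ∈ IntermediateField.adjoin ℚ (Set.range x) :=
  prod_mem fun i _ => pow_mem (IntermediateField.subset_adjoin ℚ _ (Set.mem_range_self i)) _

theorem radMon_mem_span_mod {x : ι → ℝ} {a : ι → ℕ} {k : ℕ} (hk : 0 < k)
    (h : ∀ i, x i ^ k = a i) (e : ι → ℕ) :
    radMon x e ∈ Submodule.span ℚ (Set.range fun f : ι → Fin k => radMon x fun i => (f i : ℕ)) := by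
  have hsplit : radMon x e = ((∏ i, a i ^ (e i / k) : ℕ) : ℚ) •
      radMon x (fun i => e i % k) := by
    rw [Rat.smul_def]
    push_cast
    rw [radMon, radMon, ← Finset.prod_mul_distrib]
    refine Finset.prod_congr rfl fun i _ => ?_
    rw [← h i, ← pow_mul, ← pow_add, Nat.div_add_mod]
  rw [hsplit]
  exact Submodule.smul_mem _ _ (Submodule.subset_span ⟨fun i => ⟨e i % k, Nat.mod_lt _ hk⟩, rfl⟩)

theorem isIntegral_of_pow_eq_nat {x : ℝ} {a k : ℕ} (hk : 0 < k) (h : x ^ k = a) :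
    IsIntegral ℚ x := by
  refine IsIntegral.of_pow hk ?_
  rw [h]
  simpa using isIntegral_algebraMap (R := ℚ) (A := ℝ) (x := (a : ℚ))

/-- The generators are algebraic, so the field is the algebra they generate. It is spanned by
monomials, whose exponents reduce modulo `k` at the cost of an integer factor. -/
theorem adjoin_le_span_radMon {x : ι → ℝ} {a : ι → ℕ} {k : ℕ} (hk : 0 < k)
    (h : ∀ i, x i ^ k = a i) {y : ℝ} (hy : y ∈ IntermediateField.adjoin ℚ (Set.range x)) :
    y ∈ Submodule.span ℚ (Set.range fun f : ι → Fin k => radMon x fun i => (f i : ℕ)) := by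
  have halg : ∀ z ∈ Set.range x, IsAlgebraic ℚ z := by
    rintro _ ⟨i, rfl⟩
    exact (isIntegral_of_pow_eq_nat hk (h i)).isAlgebraic
  have hy' : y ∈ (IntermediateField.adjoin ℚ (Set.range x)).toSubalgebra := hy
  rw [IntermediateField.adjoin_toSubalgebra_of_isAlgebraic halg, ← Subalgebra.mem_toSubmodule,
    Algebra.adjoin_eq_span] at hy'
  refine Submodule.span_le.2 ?_ hy'
  rintro z hz
  obtain ⟨e, rfl⟩ := Submonoid.mem_closure_range_iff.1 hz
  have := radMon_mem_span_mod hk h e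
  rw [radMon] at this
  rwa [SetLike.mem_coe, Finsupp.prod_fintype _ _ (by simp)]

theorem finiteDimensional_adjoin_radicals {x : ι → ℝ} {a : ι → ℕ} {k : ℕ} (hk : 0 < k)
    (h : ∀ i, x i ^ k = a i) :
    FiniteDimensional ℚ (IntermediateField.adjoin ℚ (Set.range x)) := by
  refine IntermediateField.finiteDimensional_adjoin ?_
  rintro _ ⟨i, rfl⟩
  exact isIntegral_of_pow_eq_nat hk (h i)

theorem finrank_adjoin_radicals_le {x : ι → ℝ} {a : ι → ℕ} {k : ℕ} (hk : 0 < k)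
    (h : ∀ i, x i ^ k = a i) :
    Module.finrank ℚ (IntermediateField.adjoin ℚ (Set.range x)) ≤ k ^ Fintype.card ι := by
  classical
  set S := Submodule.span ℚ (Set.range fun f : ι → Fin k => radMon x fun i => (f i : ℕ))
  have hle : Subalgebra.toSubmodule (IntermediateField.adjoin ℚ (Set.range x)).toSubalgebra ≤ S :=
    fun y hy => adjoin_le_span_radMon hk h hy
  have : FiniteDimensional ℚ S := FiniteDimensional.span_of_finite ℚ (Set.finite_range _)
  have h1 := Submodule.finrank_mono hle
  have h2 := finrank_range_le_card (R := ℚ) (fun f : ι → Fin k => radMon x fun i => (f i : ℕ))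
  rw [Fintype.card_fun, Fintype.card_fin] at h2
  exact h1.trans h2

/-- Otherwise no product of `y` with a monomial is rational, so the functional `z ↦ Tr (y * z)`
kills every monomial and hence the whole field. At `z = y⁻¹`, however, it takes the value `[K : ℚ] ≠
0`. -/
theorem exists_eq_rat_mul_radMon {x : ι → ℝ} {a : ι → ℕ} {k : ℕ} (hk : 0 < k)
    (hx : ∀ i, 0 < x i) (h : ∀ i, x i ^ k = a i) {y : ℝ} {b : ℕ} (hy : 0 < y) (hyb : y ^ k = b)
    (hmem : y ∈ IntermediateField.adjoin ℚ (Set.range x)) :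
    ∃ (c : ℚ) (e : ι → ℕ), y = c * radMon x e := by
  by_contra! hcon
  have := finiteDimensional_adjoin_radicals hk h
  set K := IntermediateField.adjoin ℚ (Set.range x) with hK
  let τ : K →ₗ[ℚ] ℚ := (Algebra.trace ℚ K) ∘ₗ LinearMap.mulLeft ℚ (⟨y, hmem⟩ : K)
  have hτ : ∀ e : ι → ℕ, τ ⟨radMon x e, radMon_mem_adjoin x e⟩ = 0 := by
    intro e
    refine trace_eq_zero_of_pow_eq_rat (k := k) (q := ((b * ∏ i, a i ^ e i : ℕ) : ℚ)) ?_ hk ?_ ?_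
    · exact mul_pos hy (radMon_pos hx e)
    · change (y * radMon x e) ^ k = _
      rw [mul_pow, hyb, radMon_pow h]
      push_cast
      ring
    · intro c hc
      change y * radMon x e = c at hc
      -- The inverse of a monomial `M` is `M ^ (k - 1) / M ^ k`, and `M ^ k` is a positive integer.
      refine hcon (c / ((∏ i, a i ^ e i : ℕ) : ℚ)) (fun i => (k - 1) * e i) ?_
      have hpos := radMon_pos hx e
      rw [radMon_smul, Rat.cast_div, Rat.cast_natCast, ← radMon_pow h, ← hc]
      obtain ⟨m, rfl⟩ : ∃ m, k = m + 1 := ⟨k - 1, by omega⟩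
      rw [Nat.add_sub_cancel, pow_succ]
      field_simp
  have hzero : τ = 0 := by
    have key : ∀ z ∈ Submodule.span ℚ
        (Set.range fun f : ι → Fin k => radMon x fun i => (f i : ℕ)),
        ∃ hz : z ∈ K, τ ⟨z, hz⟩ = 0 := by
      intro z hz
      induction hz using Submodule.span_induction with
      | mem z hz =>
        obtain ⟨f, rfl⟩ := hz
        exact ⟨_, hτ _⟩
      | zero => exact ⟨zero_mem K, τ.map_zero⟩
      | add u v _ _ hu hv =>
        obtain ⟨hu, hu'⟩ := hu
        obtain ⟨hv, hv'⟩ := hv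
        refine ⟨add_mem hu hv, ?_⟩
        have := τ.map_add ⟨u, hu⟩ ⟨v, hv⟩
        rw [hu', hv', add_zero] at this
        exact this
      | smul c u _ hu =>
        obtain ⟨hu, hu'⟩ := hu
        refine ⟨K.smul_mem hu, ?_⟩
        have := τ.map_smul c ⟨u, hu⟩
        rw [hu', smul_zero] at this
        exact this
    ext ⟨z, hz⟩
    obtain ⟨_, h0⟩ := key z (adjoin_le_span_radMon hk h hz)
    exact h0
  have h1 : τ (⟨y, hmem⟩ : K)⁻¹ = Module.finrank ℚ K := by
    have hne : (⟨y, hmem⟩ : K) ≠ 0 := by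
      intro h0
      exact hy.ne' (congrArg Subtype.val h0)
    change Algebra.trace ℚ K (⟨y, hmem⟩ * (⟨y, hmem⟩ : K)⁻¹) = _
    rw [mul_inv_cancel₀ hne, ← map_one (algebraMap ℚ K), Algebra.trace_algebraMap]
    simp
  rw [hzero] at h1
  have h2 : 0 < Module.finrank ℚ K := Module.finrank_pos
  have h3 : (Module.finrank ℚ K : ℚ) = 0 := h1.symm
  exact h2.ne' (by exact_mod_cast h3)

/-- After clearing denominators, the `k`-th powers contribute multiples of `k` to each valuation. -/
theorem modEq_of_pow_eq_rat_pow_mul {a : ι → ℕ} (ha : ∀ i, a i ≠ 0) {k b : ℕ} (hb : b ≠ 0)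
    {c : ℚ} {e : ι → ℕ} (hbc : (b : ℚ) = c ^ k * ∏ i, (a i : ℚ) ^ e i) (p : ℕ) :
    b.factorization p ≡ ∑ i, e i * (a i).factorization p [MOD k] := by
  have hprod : (∏ i, a i ^ e i) ≠ 0 := Finset.prod_ne_zero_iff.2 fun i _ => pow_ne_zero _ (ha i)
  have hnat : b * c.den ^ k = c.num.natAbs ^ k * ∏ i, a i ^ e i := by
    have hden : (c.den : ℚ) ≠ 0 := by exact_mod_cast c.den_ne_zero
    have h1 : (b : ℚ) * (c.den : ℚ) ^ k = (c.num : ℚ) ^ k * ∏ i, (a i : ℚ) ^ e i := by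
      rw [hbc]
      have : (c.num : ℚ) = c * c.den := (Rat.mul_den_eq_num c).symm
      rw [this, mul_pow]
      ring
    have h2 : (b : ℤ) * (c.den : ℤ) ^ k = c.num ^ k * ∏ i, (a i : ℤ) ^ e i := by
      exact_mod_cast h1
    have h3 := congrArg Int.natAbs h2
    rw [Int.natAbs_mul, Int.natAbs_mul, Int.natAbs_pow, Int.natAbs_pow] at h3
    have h4 : (∏ i, (a i : ℤ) ^ e i).natAbs = ∏ i, a i ^ e i := by
      rw [← Int.natAbs_natCast (∏ i, a i ^ e i)]
      push_cast
      rfl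
    rw [h4] at h3
    simpa using h3
  have hnum : c.num.natAbs ^ k ≠ 0 := by
    intro h0
    rw [h0, zero_mul] at hnat
    exact mul_ne_zero hb (pow_ne_zero _ c.den_ne_zero) hnat
  have hf := congrArg (fun m => m.factorization p) hnat
  simp only [Nat.factorization_mul hb (pow_ne_zero k c.den_ne_zero),
    Nat.factorization_mul hnum hprod, Nat.factorization_pow,
    Nat.factorization_prod (fun i _ => pow_ne_zero (e i) (ha i)),
    Finsupp.add_apply, Finsupp.smul_apply, smul_eq_mul, Finsupp.finsetSum_apply] at hf
  have h5 : b.factorization p + k * c.den.factorization p ≡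
      (∑ i, e i * (a i).factorization p) + k * c.num.natAbs.factorization p [MOD k] := by
    rw [hf, add_comm]
  simpa [Nat.ModEq] using h5

theorem modEq_of_mem_adjoin_radicals {x : ι → ℝ} {a : ι → ℕ} {k : ℕ} (hk : 0 < k)
    (hx : ∀ i, 0 < x i) (h : ∀ i, x i ^ k = a i) {y : ℝ} {b : ℕ} (hy : 0 < y) (hyb : y ^ k = b)
    (hmem : y ∈ IntermediateField.adjoin ℚ (Set.range x)) :
    ∃ e : ι → ℕ, ∀ p, b.factorization p ≡ ∑ i, e i * (a i).factorization p [MOD k] := by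
  obtain ⟨c, e, hce⟩ := exists_eq_rat_mul_radMon hk hx h hy hyb hmem
  have ha : ∀ i, a i ≠ 0 := fun i h0 => by
    have := h i
    rw [h0, Nat.cast_zero] at this
    exact (pow_pos (hx i) k).ne' this
  have hb : b ≠ 0 := fun h0 => by
    rw [h0, Nat.cast_zero] at hyb
    exact (pow_pos hy k).ne' hyb
  refine ⟨e, modEq_of_pow_eq_rat_pow_mul ha hb (c := c) ?_⟩
  have h1 : (b : ℝ) = (c : ℝ) ^ k * ((∏ i, a i ^ e i : ℕ) : ℝ) := by
    rw [← hyb, hce, mul_pow, radMon_pow h]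
  exact_mod_cast h1

/-- The `k ^ n` reduced monomials are linearly independent: multiplying a relation by the `(k -
1)`-st power of one of them makes that term rational and leaves the others irrational, so the trace
isolates its coefficient. -/
theorem finrank_adjoin_radicals_eq {x : ι → ℝ} {a : ι → ℕ} {k : ℕ} (hk : 0 < k)
    (hx : ∀ i, 0 < x i) (h : ∀ i, x i ^ k = a i)
    (hind : ∀ e : ι → ℕ, (∀ p, 0 ≡ ∑ i, e i * (a i).factorization p [MOD k]) → ∀ i, k ∣ e i) :
    Module.finrank ℚ (IntermediateField.adjoin ℚ (Set.range x)) = k ^ Fintype.card ι := by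
  classical
  refine le_antisymm (finrank_adjoin_radicals_le hk h) ?_
  have := finiteDimensional_adjoin_radicals hk h
  set K := IntermediateField.adjoin ℚ (Set.range x) with hK
  have ha : ∀ i, a i ≠ 0 := fun i h0 => by
    have := h i
    rw [h0, Nat.cast_zero] at this
    exact (pow_pos (hx i) k).ne' this
  have hrat : ∀ (e : ι → ℕ) (c : ℚ), radMon x e = c → ∀ i, k ∣ e i := by
    intro e c hc
    refine hind e fun p => ?_
    have hc0 : c ≠ 0 := by
      rintro rfl
      exact (radMon_pos hx e).ne' (by simpa using hc)
    have h1 : ((1 : ℕ) : ℚ) = (c⁻¹) ^ k * ∏ i, (a i : ℚ) ^ e i := by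
      have h2 : (c : ℝ) ^ k = ((∏ i, a i ^ e i : ℕ) : ℝ) := by rw [← hc, radMon_pow h]
      have h3 : c ^ k = ∏ i, (a i : ℚ) ^ e i := by exact_mod_cast h2
      rw [← h3, ← mul_pow, inv_mul_cancel₀ hc0]
      simp
    simpa using modEq_of_pow_eq_rat_pow_mul ha one_ne_zero h1 p
  let m : (ι → ℕ) → K := fun e => ⟨radMon x e, radMon_mem_adjoin x e⟩
  have hli : LinearIndependent ℚ fun f : ι → Fin k => m fun i => (f i : ℕ) := by
    rw [Fintype.linearIndependent_iff]
    intro g hg f₀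
    have hmul : ∀ f : ι → Fin k, (m fun i => (f i : ℕ)) * (m fun i => (k - 1) * (f₀ i : ℕ)) =
        m ((fun i => (f i : ℕ)) + fun i => (k - 1) * (f₀ i : ℕ)) := by
      intro f
      exact Subtype.ext (radMon_add x _ _).symm
    have htr : ∀ f : ι → Fin k, f ≠ f₀ →
        Algebra.trace ℚ K (m ((fun i => (f i : ℕ)) + fun i => (k - 1) * (f₀ i : ℕ))) = 0 := by
      intro f hf
      refine trace_eq_zero_of_pow_eq_rat (radMon_pos hx _) hk
        (q := ((∏ i, a i ^ ((f i : ℕ) + (k - 1) * (f₀ i : ℕ)) : ℕ) : ℚ)) ?_ ?_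
      · rw [Rat.cast_natCast]
        exact radMon_pow h _
      · intro c hc
        apply hf
        funext i
        have h1 : k ∣ (f i : ℕ) + (k - 1) * (f₀ i : ℕ) := hrat _ c hc i
        have h2 : (f i : ℕ) + (k - 1) * (f₀ i : ℕ) + f₀ i = f i + k * f₀ i := by
          obtain ⟨m, rfl⟩ : ∃ m, k = m + 1 := ⟨k - 1, by omega⟩
          rw [Nat.add_sub_cancel]
          ring
        have h3 : (f₀ i : ℕ) ≡ f i [MOD k] := by
          have h4 : (f i : ℕ) + (k - 1) * (f₀ i : ℕ) + f₀ i ≡ 0 + f₀ i [MOD k] :=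
            Nat.ModEq.add_right _ ((Nat.modEq_zero_iff_dvd).2 h1)
          rw [h2] at h4
          simpa [Nat.ModEq] using h4.symm
        have h5 := Nat.ModEq.eq_of_lt_of_lt h3 (f₀ i).2 (f i).2
        exact Fin.ext h5.symm
    have hsum : ∑ f, g f * Algebra.trace ℚ K
        (m ((fun i => (f i : ℕ)) + fun i => (k - 1) * (f₀ i : ℕ))) = 0 := by
      have h1 := congrArg (fun z => Algebra.trace ℚ K (z * (m fun i => (k - 1) * (f₀ i : ℕ)))) hg
      simp only [Finset.sum_mul, map_sum, zero_mul, map_zero, smul_mul_assoc, map_smul, hmul,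
        smul_eq_mul] at h1
      exact h1
    rw [Finset.sum_eq_single f₀ (fun f _ hf => by rw [htr f hf, mul_zero]) (by simp)] at hsum
    refine (mul_eq_zero.1 hsum).resolve_right ?_
    have hself : m ((fun i => (f₀ i : ℕ)) + fun i => (k - 1) * (f₀ i : ℕ)) =
        algebraMap ℚ K ((∏ i, a i ^ (f₀ i : ℕ) : ℕ) : ℚ) := by
      refine Subtype.ext ?_
      have h2 : ((fun i => (f₀ i : ℕ)) + fun i => (k - 1) * (f₀ i : ℕ)) =
          fun i => k * (f₀ i : ℕ) := by
        funext i
        obtain ⟨m, rfl⟩ : ∃ m, k = m + 1 := ⟨k - 1, by omega⟩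
        simp only [Pi.add_apply, Nat.add_sub_cancel]
        ring
      change radMon x _ = _
      rw [h2, radMon_smul, radMon_pow h]
      simp
    rw [hself, Algebra.trace_algebraMap, nsmul_eq_mul]
    refine mul_ne_zero ?_ ?_
    · exact_mod_cast (Module.finrank_pos (R := ℚ) (M := K)).ne'
    · exact_mod_cast Finset.prod_ne_zero_iff.2 fun i _ => pow_ne_zero _ (ha i)
  have := hli.fintype_card_le_finrank
  simpa using this

end Radicals

/-! ### Rankin's method -/

theorem sum_Icc_rpow_neg_le (s : ℝ) (hs : 1 < s) (H : ℕ) :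
    ∑ m ∈ Finset.Icc 1 H, (m : ℝ) ^ (-s) ≤ ∑' m : ℕ, (m : ℝ) ^ (-s) :=
  (Real.summable_nat_rpow.2 (by linarith)).sum_le_tsum _ fun m _ => by positivity

/-- Rankin's bound for the number of tuples in `[1, H]` all of whose nonzero vectors of `p`-adic
valuations lie in a finite set `V`. -/
theorem exists_card_factorization_mem_le {ι : Type*} [Fintype ι] [DecidableEq ι] (σ : ι → ℝ)
    (hσ : ∀ i, 0 ≤ σ i) (V : Finset (ι → ℕ)) (hV : ∀ v ∈ V, 1 < ∑ i, σ i * v i) :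
    ∃ C : ℝ, ∀ (H : ℕ) (S : Finset (ι → ℕ)),
      (∀ f ∈ S, (∀ i, 1 ≤ f i ∧ f i ≤ H) ∧
        ∀ p : ℕ, (fun i => (f i).factorization p) ∈ insert 0 V) →
      (S.card : ℝ) ≤ C * (H : ℝ) ^ ∑ i, σ i := by
  classical
  refine ⟨∏ v : V, ∑' m : ℕ, (m : ℝ) ^ (-∑ i, σ i * (v : ι → ℕ) i), fun H S hS => ?_⟩
  set T : Finset (V → ℕ) := {g ∈ Fintype.piFinset fun _ : V => Finset.Icc 1 H |
    ∀ i, ∏ v : V, g v ^ (v : ι → ℕ) i ≤ H} with hT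
  have hST : S ⊆ T.image fun g i => ∏ v : V, g v ^ (v : ι → ℕ) i := by
    intro f hf
    obtain ⟨hfH, hfV⟩ := hS f hf
    set P : Finset ℕ := (Finset.range (H + 1)).filter Nat.Prime with hP
    set vec : ℕ → ι → ℕ := fun p i => (f i).factorization p with hvec
    -- Sorting primes by valuation vector parametrizes the tuple: `g v` is the product of the primes
    -- with vector `v`, and `f i = ∏ g v ^ v i`.
    set g : V → ℕ := fun v => ∏ p ∈ P with vec p = v, p with hg
    have hgf : ∀ i, ∏ v : V, g v ^ (v : ι → ℕ) i = f i := by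
      intro i
      have h1 : f i = ∏ p ∈ P, p ^ vec p i := by
        have hsub : (f i).factorization.support ⊆ P := by
          intro p hp
          rw [Nat.support_factorization, Nat.mem_primeFactors] at hp
          simp only [hP, Finset.mem_filter, Finset.mem_range]
          refine ⟨?_, hp.1⟩
          have := Nat.le_of_dvd (hfH i).1 hp.2.1
          have := (hfH i).2
          omega
        conv_lhs => rw [← Nat.prod_factorization_pow_eq_self (by have := (hfH i).1; omega : f i ≠ 0)]
        exact Finsupp.prod_of_support_subset _ hsub _ (by simp)
      rw [h1, ← Finset.prod_fiberwise_of_maps_to (s := P) (t := insert 0 V) (g := vec)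
        (fun p _ => hfV p)]
      have h0 : (0 : ι → ℕ) ∉ V := by
        intro h0
        have := hV 0 h0
        simp at this
        linarith
      have hone : ∏ p ∈ P with vec p = 0, p ^ vec p i = 1 := by
        refine Finset.prod_eq_one fun p hp => ?_
        rw [(Finset.mem_filter.1 hp).2, Pi.zero_apply, pow_zero]
      rw [Finset.prod_insert h0, hone, one_mul, ← Finset.prod_coe_sort V]
      refine Finset.prod_congr rfl fun v _ => ?_
      rw [hg, ← Finset.prod_pow]
      refine Finset.prod_congr rfl fun p hp => ?_
      rw [(Finset.mem_filter.1 hp).2]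
    have hgpos : ∀ v, 1 ≤ g v := by
      intro v
      change 0 < ∏ p ∈ P with vec p = v, p
      refine Finset.prod_pos fun p hp => ?_
      have hp' : p ∈ P := (Finset.mem_filter.1 hp).1
      exact (Finset.mem_filter.1 hp').2.pos
    refine Finset.mem_image.2 ⟨g, ?_, funext hgf⟩
    rw [hT, Finset.mem_filter, Fintype.mem_piFinset]
    refine ⟨fun v => Finset.mem_Icc.2 ⟨hgpos v, ?_⟩, fun i => by rw [hgf]; exact (hfH i).2⟩
    obtain ⟨i, hi⟩ : ∃ i, (v : ι → ℕ) i ≠ 0 := by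
      by_contra! h0
      have := hV v v.2
      simp [h0] at this
      linarith
    calc g v ≤ g v ^ (v : ι → ℕ) i := Nat.le_self_pow hi _
      _ ≤ ∏ v : V, g v ^ (v : ι → ℕ) i :=
        Finset.single_le_prod' (f := fun v : V => g v ^ (v : ι → ℕ) i)
          (fun w _ => Nat.one_le_pow _ _ (hgpos w)) (Finset.mem_univ v)
      _ = f i := hgf i
      _ ≤ H := (hfH i).2
  have hcard : (S.card : ℝ) ≤ T.card := by
    exact_mod_cast (Finset.card_le_card hST).trans Finset.card_image_le
  refine hcard.trans ?_
  have hterm : ∀ g ∈ Fintype.piFinset (fun _ : V => Finset.Icc 1 H),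
      (H : ℝ) ^ (∑ i, σ i) * ∏ v : V, (g v : ℝ) ^ (-∑ i, σ i * (v : ι → ℕ) i) =
      ∏ i, ((H : ℝ) / (∏ v : V, g v ^ (v : ι → ℕ) i : ℕ)) ^ σ i := by
    intro g hg
    rw [Fintype.mem_piFinset] at hg
    have hgpos : ∀ v, (0 : ℝ) < g v := fun v => by exact_mod_cast (Finset.mem_Icc.1 (hg v)).1
    have h1 : ∀ i, ((H : ℝ) / (∏ v : V, g v ^ (v : ι → ℕ) i : ℕ)) ^ σ i =
        (H : ℝ) ^ σ i * ∏ v : V, (g v : ℝ) ^ (-(σ i * (v : ι → ℕ) i)) := by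
      intro i
      rw [Real.div_rpow (by positivity) (by positivity), div_eq_mul_inv]
      congr 1
      push_cast
      rw [← Real.finsetProd_rpow _ _ (fun v _ => by positivity), ← Finset.prod_inv_distrib]
      refine Finset.prod_congr rfl fun v _ => ?_
      rw [Real.rpow_neg (hgpos v).le, mul_comm (σ i), Real.rpow_mul (hgpos v).le,
        Real.rpow_natCast]
    simp_rw [h1]
    rw [Finset.prod_mul_distrib, ← Real.rpow_sum_of_nonneg (by positivity) (fun i _ => hσ i),
      Finset.prod_comm]
    congr 1
    refine Finset.prod_congr rfl fun v _ => ?_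
    rw [← Real.rpow_sum_of_pos (hgpos v), Finset.sum_neg_distrib]
  -- Each `g ∈ T` is counted with weight `∏ (H / f i) ^ σ i ≥ 1`. Dropping the constraints `f i ≤ H`
  -- then makes the sum factor over `v`, and `hV` makes each factor converge.
  calc (T.card : ℝ) = ∑ g ∈ T, (1 : ℝ) := by simp
    _ ≤ ∑ g ∈ T, (H : ℝ) ^ (∑ i, σ i) *
          ∏ v : V, (g v : ℝ) ^ (-∑ i, σ i * (v : ι → ℕ) i) := by
        refine Finset.sum_le_sum fun g hg => ?_
        rw [hT, Finset.mem_filter] at hg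
        rw [hterm g hg.1]
        rw [Fintype.mem_piFinset] at hg
        have hle : ∀ i, (1 : ℝ) ≤ ((H : ℝ) / (∏ v : V, g v ^ (v : ι → ℕ) i : ℕ)) ^ σ i := by
          intro i
          refine Real.one_le_rpow ?_ (hσ i)
          have hpos : 0 < ∏ v : V, g v ^ (v : ι → ℕ) i :=
            Finset.prod_pos fun v _ => pow_pos (Finset.mem_Icc.1 (hg.1 v)).1 _
          rw [one_le_div (by exact_mod_cast hpos)]
          exact_mod_cast hg.2 i
        exact Finset.one_le_prod fun i _ => hle i
    _ ≤ ∑ g ∈ Fintype.piFinset (fun _ : V => Finset.Icc 1 H), (H : ℝ) ^ (∑ i, σ i) *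
          ∏ v : V, (g v : ℝ) ^ (-∑ i, σ i * (v : ι → ℕ) i) :=
        Finset.sum_le_sum_of_subset_of_nonneg (Finset.filter_subset _ _)
          fun g _ _ => by positivity
    _ = (H : ℝ) ^ (∑ i, σ i) *
          ∏ v : V, ∑ m ∈ Finset.Icc 1 H, (m : ℝ) ^ (-∑ i, σ i * (v : ι → ℕ) i) := by
        rw [← Finset.mul_sum, Finset.prod_univ_sum]
    _ ≤ (H : ℝ) ^ (∑ i, σ i) *
          ∏ v : V, ∑' m : ℕ, (m : ℝ) ^ (-∑ i, σ i * (v : ι → ℕ) i) := by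
        refine mul_le_mul_of_nonneg_left ?_ (by positivity)
        refine Finset.prod_le_prod (fun v _ => Finset.sum_nonneg fun m _ => by positivity)
          fun v _ => ?_
        exact sum_Icc_rpow_neg_le _ (hV v v.2) H
    _ = _ := mul_comm _ _

/-! ### Counting power free integers -/

/-- The `k`-th power free integers in `[1, H]`. -/
def powerFree (k H : ℕ) : Finset ℕ := {m ∈ Finset.Icc 1 H | Nat.floorRoot k m = 1}

theorem mem_powerFree {k H m : ℕ} :
    m ∈ powerFree k H ↔ (1 ≤ m ∧ m ≤ H) ∧ Nat.floorRoot k m = 1 := by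
  simp [powerFree]

theorem card_powerFree_le (k H : ℕ) : (powerFree k H).card ≤ H := by
  refine (Finset.card_filter_le _ _).trans ?_
  simp

theorem factorization_lt_of_floorRoot_eq_one {k m : ℕ} (hk : 0 < k)
    (h : Nat.floorRoot k m = 1) (p : ℕ) : m.factorization p < k := by
  have h1 := congrArg (fun a => a.factorization p) h
  simp only [Nat.factorization_floorRoot, Nat.factorization_one, Finsupp.floorDiv_apply,
    Finsupp.zero_apply, Nat.floorDiv_eq_div] at h1
  exact (Nat.div_eq_zero_iff.1 h1).resolve_left hk.ne'

theorem sum_moebius_divisors (m : ℕ) :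
    ∑ d ∈ m.divisors, (ArithmeticFunction.moebius d : ℤ) = if m = 1 then 1 else 0 := by
  have h := congrArg (fun f => f m) ArithmeticFunction.moebius_mul_coe_zeta
  simp only [ArithmeticFunction.coe_mul_zeta_apply, ArithmeticFunction.one_apply] at h
  exact h

/-- The divisors of `Nat.floorRoot k m` are exactly the `d` with `d ^ k ∣ m`, so Möbius summation
over them detects power freeness. -/
theorem card_powerFree_eq (k H : ℕ) (hk : 0 < k) :
    ((powerFree k H).card : ℤ) =
      ∑ d ∈ Finset.Icc 1 H, ArithmeticFunction.moebius d * ((H / d ^ k : ℕ) : ℤ) := by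
  have h1 : ((powerFree k H).card : ℤ) = ∑ m ∈ Finset.Icc 1 H,
      ∑ d ∈ Finset.Icc 1 H, if d ^ k ∣ m then ArithmeticFunction.moebius d else 0 := by
    rw [powerFree, Finset.card_filter]
    push_cast
    refine Finset.sum_congr rfl fun m hm => ?_
    rw [Finset.mem_Icc] at hm
    have hroot : Nat.floorRoot k m ≠ 0 := Nat.floorRoot_ne_zero.2 ⟨hk.ne', by omega⟩
    rw [← sum_moebius_divisors _, ← Finset.sum_filter]
    refine Finset.sum_congr ?_ fun _ _ => rfl
    ext d
    rw [Nat.mem_divisors, Finset.mem_filter, Finset.mem_Icc, Nat.pow_dvd_iff_dvd_floorRoot]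
    refine ⟨fun h => ⟨⟨Nat.pos_of_dvd_of_pos h.1 (by omega), ?_⟩, h.1⟩, fun h => ⟨h.2, hroot⟩⟩
    have h2 : d ^ k ∣ m := Nat.pow_dvd_iff_dvd_floorRoot.2 h.1
    exact (Nat.le_self_pow hk.ne' d).trans ((Nat.le_of_dvd (by omega) h2).trans hm.2)
  rw [h1, Finset.sum_comm]
  refine Finset.sum_congr rfl fun d _ => ?_
  rw [← Finset.sum_filter, Finset.sum_const, nsmul_eq_mul, mul_comm]
  congr 2
  rw [← Nat.Ioc_filter_dvd_card_eq_div]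
  rfl

/-- The density `∑ μ(d) / d ^ k = 1 / ζ(k)` of the `k`-th power free integers. -/
noncomputable def powerFreeDensity (k : ℕ) : ℝ :=
  ∑' d : ℕ, (ArithmeticFunction.moebius d : ℝ) / (d : ℝ) ^ k

theorem summable_moebius_div_pow {k : ℕ} (hk : 2 ≤ k) :
    Summable fun d : ℕ => (ArithmeticFunction.moebius d : ℝ) / (d : ℝ) ^ k := by
  refine Summable.of_norm_bounded (Real.summable_one_div_nat_pow.2 hk) fun d => ?_
  rw [norm_div, norm_pow, Real.norm_natCast]
  gcongr
  have : |ArithmeticFunction.moebius d| ≤ 1 := ArithmeticFunction.abs_moebius_le_one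
  rw [Real.norm_eq_abs]
  exact_mod_cast this

theorem powerFreeDensity_eq {k : ℕ} (hk : 2 ≤ k) :
    (powerFreeDensity k : ℂ) = 1 / riemannZeta (k : ℂ) := by
  have hre : 1 < ((k : ℂ)).re := by
    rw [Complex.natCast_re]
    exact_mod_cast hk
  have h := ArithmeticFunction.LSeries_zeta_mul_Lseries_moebius hre
  rw [ArithmeticFunction.LSeries_zeta_eq_riemannZeta hre] at h
  have hL : LSeries (fun n => ((ArithmeticFunction.moebius n : ℤ) : ℂ)) k =
      (powerFreeDensity k : ℂ) := by
    rw [LSeries, powerFreeDensity, Complex.ofReal_tsum]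
    refine tsum_congr fun d => ?_
    rcases Nat.eq_zero_or_pos d with rfl | hd
    · simp
    · rw [LSeries.term_of_ne_zero hd.ne', Complex.cpow_natCast]
      push_cast
      rfl
  rw [hL] at h
  exact eq_one_div_of_mul_eq_one_right h

/-- A fractional part is at most `min 1 y ≤ √y`. Since `k ≥ 3`, the resulting bound is summable over
all `d`, including `d > H`, so the series needs no truncation. -/
theorem abs_natDiv_sub_div_le {k : ℕ} (hk : 3 ≤ k) (H d : ℕ) (hd : 1 ≤ d) :
    |((H / d ^ k : ℕ) : ℝ) - (H : ℝ) / (d : ℝ) ^ k| ≤ Real.sqrt H * (d : ℝ) ^ (-(3 / 2 : ℝ)) := by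
  set y : ℝ := (H : ℝ) / (d : ℝ) ^ k with hy
  have hd' : (1 : ℝ) ≤ d := by exact_mod_cast hd
  have hy0 : 0 ≤ y := by positivity
  have hfloor : ((H / d ^ k : ℕ) : ℝ) = (⌊y⌋₊ : ℝ) := by
    rw [hy, ← Nat.cast_pow, Nat.floor_div_eq_div]
  have h1 : |((H / d ^ k : ℕ) : ℝ) - y| ≤ Real.sqrt y := by
    rw [hfloor, abs_sub_comm, abs_of_nonneg (sub_nonneg.2 (Nat.floor_le hy0))]
    refine Real.le_sqrt_of_sq_le ?_
    have ha := Nat.lt_floor_add_one y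
    have hb := Nat.floor_le hy0
    have hc : (0 : ℝ) ≤ ⌊y⌋₊ := Nat.cast_nonneg _
    nlinarith
  refine h1.trans ?_
  have h3 : y ≤ (H : ℝ) / (d : ℝ) ^ 3 := by
    rw [hy]
    gcongr
  refine (Real.sqrt_le_sqrt h3).trans (le_of_eq ?_)
  rw [Real.sqrt_div (by positivity), div_eq_mul_inv, Real.rpow_neg (by positivity),
    Real.sqrt_eq_rpow ((d : ℝ) ^ 3), ← Real.rpow_natCast, ← Real.rpow_mul (by positivity)]
  norm_num

theorem exists_abs_card_powerFree_sub_le {k : ℕ} (hk : 3 ≤ k) :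
    ∃ C : ℝ, ∀ H : ℕ, |((powerFree k H).card : ℝ) - powerFreeDensity k * H| ≤ C * Real.sqrt H := by
  refine ⟨∑' d : ℕ, (d : ℝ) ^ (-(3 / 2 : ℝ)), fun H => ?_⟩
  have hs := summable_moebius_div_pow (k := k) (by omega)
  have hzero : ∀ d ∉ Finset.Icc 1 H,
      (ArithmeticFunction.moebius d : ℝ) * ((H / d ^ k : ℕ) : ℝ) = 0 := by
    intro d hd
    rcases Nat.eq_zero_or_pos d with rfl | hd0
    · simp
    · have hHd : H < d := by
        by_contra! hle
        exact hd (Finset.mem_Icc.2 ⟨hd0, hle⟩)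
      rw [Nat.div_eq_of_lt (hHd.trans_le (Nat.le_self_pow (by omega) d))]
      simp
  have hcard : HasSum (fun d : ℕ => (ArithmeticFunction.moebius d : ℝ) * ((H / d ^ k : ℕ) : ℝ))
      ((powerFree k H).card : ℝ) := by
    have h1 : ((powerFree k H).card : ℝ) =
        ∑ d ∈ Finset.Icc 1 H, (ArithmeticFunction.moebius d : ℝ) * ((H / d ^ k : ℕ) : ℝ) := by
      have := congrArg (Int.cast (R := ℝ)) (card_powerFree_eq k H (by omega))
      push_cast at this ⊢
      exact this
    rw [h1]
    exact hasSum_sum_of_ne_finset_zero hzero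
  have hdens : HasSum (fun d : ℕ => (ArithmeticFunction.moebius d : ℝ) / (d : ℝ) ^ k * H)
      (powerFreeDensity k * H) := hs.hasSum.mul_right _
  have hsub := hcard.sub hdens
  have hdom : Summable fun d : ℕ => Real.sqrt H * (d : ℝ) ^ (-(3 / 2 : ℝ)) :=
    (Real.summable_nat_rpow.2 (by norm_num)).mul_left _
  rw [← Real.norm_eq_abs, ← hsub.tsum_eq, mul_comm, ← tsum_mul_left]
  refine tsum_of_norm_bounded hdom.hasSum fun d => ?_
  rcases Nat.eq_zero_or_pos d with rfl | hd0
  · simp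
  · have hmu : |(ArithmeticFunction.moebius d : ℝ)| ≤ 1 := by
      exact_mod_cast ArithmeticFunction.abs_moebius_le_one
    have hrew : (ArithmeticFunction.moebius d : ℝ) * ((H / d ^ k : ℕ) : ℝ) -
        (ArithmeticFunction.moebius d : ℝ) / (d : ℝ) ^ k * H =
        (ArithmeticFunction.moebius d : ℝ) * (((H / d ^ k : ℕ) : ℝ) - (H : ℝ) / (d : ℝ) ^ k) := by
      ring
    rw [hrew, norm_mul, Real.norm_eq_abs, Real.norm_eq_abs]
    calc _ ≤ 1 * |((H / d ^ k : ℕ) : ℝ) - (H : ℝ) / (d : ℝ) ^ k| := by gcongr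
      _ ≤ _ := by rw [one_mul]; exact abs_natDiv_sub_div_le hk H d hd0

/-! ### Asymptotics of binomial coefficients -/

theorem exists_abs_descFactorial_sub_le (c C : ℝ) (n : ℕ) :
    ∃ C' : ℝ, ∀ H q : ℕ, 1 ≤ H → q ≤ H → |(q : ℝ) - c * H| ≤ C * Real.sqrt H →
      |(q.descFactorial n : ℝ) - (c * H) ^ n| * Real.sqrt H ≤ C' * (H : ℝ) ^ n := by
  induction n with
  | zero => exact ⟨0, fun H q _ _ _ => by simp⟩
  | succ n ih =>
    obtain ⟨C₀, h₀⟩ := ih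
    refine ⟨(C + n) + |c| * C₀, fun H q hH hq hqc => ?_⟩
    have ih' := h₀ H q hH hq hqc
    have hH' : (1 : ℝ) ≤ H := by exact_mod_cast hH
    have hs1 : 1 ≤ Real.sqrt H := Real.one_le_sqrt.2 hH'
    have hss : Real.sqrt H * Real.sqrt H = H := Real.mul_self_sqrt (by positivity)
    have hrec : (q.descFactorial (n + 1) : ℝ) = ((q : ℝ) - n) * q.descFactorial n := by
      rw [Nat.descFactorial_succ]
      -- The subtraction in `Nat.descFactorial_succ` truncates, but for `q < n` the other factor is
      -- already zero.
      rcases le_or_gt n q with hnq | hnq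
      · push_cast [hnq]
        ring
      · rw [Nat.descFactorial_of_lt hnq]
        simp
    have hD : (q.descFactorial n : ℝ) ≤ (H : ℝ) ^ n := by
      exact_mod_cast (Nat.descFactorial_le_pow q n).trans (Nat.pow_le_pow_left hq n)
    have hfac : |(q : ℝ) - n - c * H| * Real.sqrt H ≤ (C + n) * H := by
      have h1 : |(q : ℝ) - n - c * H| ≤ (C + n) * Real.sqrt H := by
        calc |(q : ℝ) - n - c * H| = |((q : ℝ) - c * H) - n| := by ring_nf
          _ ≤ |(q : ℝ) - c * H| + |(n : ℝ)| := abs_sub _ _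
          _ ≤ C * Real.sqrt H + n * Real.sqrt H := by
            rw [Nat.abs_cast]
            have : (n : ℝ) * 1 ≤ n * Real.sqrt H := by gcongr
            linarith
          _ = _ := by ring
      calc _ ≤ (C + n) * Real.sqrt H * Real.sqrt H := by gcongr
        _ = _ := by rw [mul_assoc, hss]
    have hsplit : (q.descFactorial (n + 1) : ℝ) - (c * H) ^ (n + 1) =
        ((q : ℝ) - n - c * H) * q.descFactorial n +
          c * H * ((q.descFactorial n : ℝ) - (c * H) ^ n) := by
      rw [hrec]
      ring
    rw [hsplit]
    have hnn : 0 ≤ (C + n) * (H : ℝ) := le_trans (by positivity) hfac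
    calc _ ≤ (|((q : ℝ) - n - c * H) * q.descFactorial n| +
          |c * H * ((q.descFactorial n : ℝ) - (c * H) ^ n)|) * Real.sqrt H := by
          gcongr
          exact abs_add_le _ _
      _ = |(q : ℝ) - n - c * H| * Real.sqrt H * q.descFactorial n +
          |c| * H * (|(q.descFactorial n : ℝ) - (c * H) ^ n| * Real.sqrt H) := by
          rw [abs_mul, abs_mul, abs_mul, Nat.abs_cast, Nat.abs_cast]
          ring
      _ ≤ (C + n) * H * (H : ℝ) ^ n + |c| * H * (C₀ * (H : ℝ) ^ n) := by gcongr
      _ = _ := by ring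

theorem exists_abs_choose_sub_le (c C : ℝ) (n : ℕ) :
    ∃ C' : ℝ, ∀ H q : ℕ, 1 ≤ H → q ≤ H → |(q : ℝ) - c * H| ≤ C * Real.sqrt H →
      |(q.choose n : ℝ) - (c * H) ^ n / n !| * Real.sqrt H ≤ C' * (H : ℝ) ^ n := by
  obtain ⟨C', h⟩ := exists_abs_descFactorial_sub_le c C n
  refine ⟨C', fun H q hH hq hqc => ?_⟩
  refine le_trans ?_ (h H q hH hq hqc)
  refine mul_le_mul_of_nonneg_right ?_ (Real.sqrt_nonneg _)
  have hn : (1 : ℝ) ≤ n ! := by exact_mod_cast n.factorial_pos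
  have h1 : (q.descFactorial n : ℝ) - (c * H) ^ n =
      n ! * ((q.choose n : ℝ) - (c * H) ^ n / n !) := by
    rw [Nat.descFactorial_eq_factorial_mul_choose]
    push_cast
    field_simp
  rw [h1, abs_mul, Nat.abs_cast]
  exact le_mul_of_one_le_left (abs_nonneg _) hn

/-! ### From fields to sets of power free integers -/

theorem rpow_one_div_pow {k : ℕ} (hk : 0 < k) (m : ℕ) :
    ((m : ℝ) ^ ((1 : ℝ) / (k : ℝ))) ^ k = m := by
  rw [one_div, Real.rpow_inv_natCast_pow m.cast_nonneg hk.ne']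

/-- The field generated by the real `k`-th roots of the elements of `A`. -/
noncomputable def rootField (k : ℕ) (A : Finset ℕ) : IntermediateField ℚ ℝ :=
  IntermediateField.adjoin ℚ (Set.range fun m : A => ((m : ℕ) : ℝ) ^ ((1 : ℝ) / (k : ℝ)))

theorem radicalField_eq_rootField (k : ℕ) {n : ℕ} (a : Fin n → ℕ) :
    radicalField k a = rootField k (Finset.univ.image a) := by
  rw [radicalField, rootField]
  congr 1
  ext y
  simp

theorem floorRoot_div_pow_floorRoot {k m : ℕ} (hk : 0 < k) (hm : m ≠ 0) :
    Nat.floorRoot k (m / Nat.floorRoot k m ^ k) = 1 := by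
  set r := Nat.floorRoot k m with hr
  have hr0 : r ≠ 0 := Nat.floorRoot_ne_zero.2 ⟨hk.ne', hm⟩
  have hdvd : r ^ k ∣ m := Nat.floorRoot_pow_dvd
  set d := Nat.floorRoot k (m / r ^ k) with hd
  have h1 : d ^ k ∣ m / r ^ k := Nat.floorRoot_pow_dvd
  have h2 : (r * d) ^ k ∣ m := by
    rw [mul_pow]
    exact (Nat.dvd_div_iff_mul_dvd hdvd).1 h1
  have h3 : r * d ∣ r * 1 := by
    rw [mul_one]
    exact Nat.pow_dvd_iff_dvd_floorRoot.1 h2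
  exact Nat.dvd_one.1 ((Nat.mul_dvd_mul_iff_left (Nat.pos_of_ne_zero hr0)).1 h3)

theorem adjoin_range_mul_natCast {ι : Type*} (x : ι → ℝ) (r : ι → ℕ) (hr : ∀ i, r i ≠ 0) :
    IntermediateField.adjoin ℚ (Set.range fun i => x i * r i) =
      IntermediateField.adjoin ℚ (Set.range x) := by
  apply le_antisymm
  · rw [IntermediateField.adjoin_le_iff]
    rintro _ ⟨i, rfl⟩
    exact mul_mem (IntermediateField.subset_adjoin ℚ _ (Set.mem_range_self i)) (natCast_mem _ _)
  · rw [IntermediateField.adjoin_le_iff]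
    rintro _ ⟨i, rfl⟩
    have h0 : (r i : ℝ) ≠ 0 := by exact_mod_cast hr i
    have h1 : x i = x i * r i * (r i : ℝ)⁻¹ := by rw [mul_inv_cancel_right₀ h0]
    rw [h1]
    exact mul_mem (IntermediateField.subset_adjoin ℚ _ ⟨i, rfl⟩) (inv_mem (natCast_mem _ _))

theorem maxDegreeFields_subset {k : ℕ} (hk : 2 ≤ k) (n H : ℕ) :
    maxDegreeFields k n H ⊆
      rootField k '' (Finset.powersetCard n (powerFree k H) : Set (Finset ℕ)) := by
  rintro K ⟨a, ha, rfl, hdeg⟩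
  set r : Fin n → ℕ := fun i => Nat.floorRoot k (a i) with hr
  set a' : Fin n → ℕ := fun i => a i / r i ^ k with ha'
  have hr0 : ∀ i, r i ≠ 0 := fun i =>
    Nat.floorRoot_ne_zero.2 ⟨by omega, by have := (ha i).1; omega⟩
  have hmul : ∀ i, a i = a' i * r i ^ k := fun i =>
    (Nat.div_mul_cancel (Nat.floorRoot_pow_dvd (n := k) (a := a i))).symm
  have hfield : radicalField k a = radicalField k a' := by
    rw [radicalField, radicalField,
      ← adjoin_range_mul_natCast (fun i => (a' i : ℝ) ^ ((1 : ℝ) / (k : ℝ))) r hr0]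
    congr 2
    funext i
    conv_lhs => rw [hmul i]
    rw [Nat.cast_mul, Real.mul_rpow (Nat.cast_nonneg _) (Nat.cast_nonneg _), Nat.cast_pow, one_div,
      Real.pow_rpow_inv_natCast (Nat.cast_nonneg _) (by omega)]
  have hmem : ∀ i, a' i ∈ powerFree k H := by
    intro i
    have h1 := (ha i).1
    refine mem_powerFree.2 ⟨⟨?_, (Nat.div_le_self _ _).trans (ha i).2⟩,
      floorRoot_div_pow_floorRoot (by omega) (by omega)⟩
    refine Nat.pos_of_ne_zero fun h0 => ?_
    have := hmul i
    rw [h0, zero_mul] at this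
    omega
  refine ⟨Finset.univ.image a', ?_, ?_⟩
  · rw [Finset.mem_coe, Finset.mem_powersetCard]
    refine ⟨fun m hm => ?_, le_antisymm (Finset.card_image_le.trans (by simp)) ?_⟩
    · obtain ⟨i, -, rfl⟩ := Finset.mem_image.1 hm
      exact hmem i
    -- If two of the `a' i` coincided, fewer than `n` radicals would generate the field and its
    -- degree would be below `k ^ n`.
    · have h1 : k ^ n ≤ k ^ (Finset.univ.image a').card := by
        rw [← hdeg, hfield, radicalField_eq_rootField, ← Fintype.card_coe]
        exact finrank_adjoin_radicals_le (by omega)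
          (a := fun m : (Finset.univ.image a' : Finset ℕ) => (m : ℕ))
          fun m => rpow_one_div_pow (by omega) m
      exact (Nat.pow_le_pow_iff_right (by omega)).1 h1
  · rw [hfield, radicalField_eq_rootField]

theorem maxDegreeCount_le {k : ℕ} (hk : 2 ≤ k) (n H : ℕ) :
    maxDegreeCount k n H ≤ (powerFree k H).card.choose n := by
  rw [maxDegreeCount, ← Finset.card_powersetCard, ← Set.ncard_coe_finset]
  exact (Set.ncard_le_ncard (maxDegreeFields_subset hk n H)
    ((Finset.finite_toSet _).image _)).trans (Set.ncard_image_le (Finset.finite_toSet _))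

/-- Some power free `b ≤ H` outside of `A` is, modulo `k`-th powers, a nontrivial product of powers
of elements of `A`.  For `b = 1` this says that `A` is multiplicatively dependent. -/
def HasExtraRadical (k H : ℕ) (A : Finset ℕ) : Prop :=
  ∃ e : A → ℕ, ∃ b ∈ powerFree k H, b ∉ A ∧ (∃ i, ¬ k ∣ e i) ∧
    ∀ p, b.factorization p ≡ ∑ i : A, e i * (i : ℕ).factorization p [MOD k]

theorem eq_of_factorization_modEq {k H a b : ℕ} (hk : 0 < k) (ha : a ∈ powerFree k H)
    (hb : b ∈ powerFree k H) (h : ∀ p, a.factorization p ≡ b.factorization p [MOD k]) :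
    a = b := by
  rw [mem_powerFree] at ha hb
  refine Nat.eq_of_factorization_eq (by omega) (by omega) fun p => ?_
  exact (h p).eq_of_lt_of_lt (factorization_lt_of_floorRoot_eq_one hk ha.2 p)
    (factorization_lt_of_floorRoot_eq_one hk hb.2 p)

theorem one_mem_powerFree {k H : ℕ} (hk : 0 < k) (hH : 1 ≤ H) : 1 ∈ powerFree k H :=
  mem_powerFree.2 ⟨⟨le_rfl, hH⟩, Nat.floorRoot_one_right hk.ne'⟩

theorem finrank_rootField {k H : ℕ} (hk : 0 < k) (hH : 1 ≤ H) {A : Finset ℕ}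
    (hA : A ⊆ (powerFree k H).erase 1) (hbad : ¬ HasExtraRadical k H A) :
    Module.finrank ℚ (rootField k A) = k ^ A.card := by
  have hpos : ∀ m : A, 0 < (m : ℕ) := fun m =>
    (mem_powerFree.1 (Finset.mem_of_mem_erase (hA m.2))).1.1
  rw [← Fintype.card_coe A]
  refine finrank_adjoin_radicals_eq hk (a := fun m : A => (m : ℕ))
    (fun m => Real.rpow_pos_of_pos (by exact_mod_cast hpos m) _)
    (fun m => rpow_one_div_pow hk m) fun e he => ?_
  by_contra! hcon
  refine hbad ⟨e, 1, one_mem_powerFree hk hH, fun h1 => ?_, hcon, fun p => by simpa using he p⟩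
  exact (Finset.mem_erase.1 (hA h1)).1 rfl

/-- The root of `b ∈ B` lies in the field of `A`, so `b` is a product of powers of elements of `A`
modulo `k`-th powers. If `b ∉ A`, either this product is trivial and `b = 1`, or `A` is exceptional.
-/
theorem subset_of_rootField_eq {k H : ℕ} (hk : 0 < k) (hH : 1 ≤ H) {A B : Finset ℕ}
    (hA : A ⊆ (powerFree k H).erase 1) (hbad : ¬ HasExtraRadical k H A)
    (hB : B ⊆ (powerFree k H).erase 1) (h : rootField k A = rootField k B) : B ⊆ A := by
  intro b hb
  by_contra hbA
  obtain ⟨hb1, hbk⟩ := Finset.mem_erase.1 (hB hb)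
  have hpos : ∀ m : A, 0 < (m : ℕ) := fun m =>
    (mem_powerFree.1 (Finset.mem_of_mem_erase (hA m.2))).1.1
  have hbpos : 0 < b := (mem_powerFree.1 hbk).1.1
  have hmem : (b : ℝ) ^ ((1 : ℝ) / (k : ℝ)) ∈ rootField k A := by
    rw [h]
    exact IntermediateField.subset_adjoin ℚ _ ⟨⟨b, hb⟩, rfl⟩
  obtain ⟨e, he⟩ := modEq_of_mem_adjoin_radicals hk (a := fun m : A => (m : ℕ))
    (fun m => Real.rpow_pos_of_pos (by exact_mod_cast hpos m) _)
    (fun m => rpow_one_div_pow hk m) (Real.rpow_pos_of_pos (by exact_mod_cast hbpos) _)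
    (rpow_one_div_pow hk b) hmem
  by_cases hdvd : ∀ i, k ∣ e i
  · refine hb1 (eq_of_factorization_modEq hk hbk (one_mem_powerFree hk hH) fun p => ?_)
    refine (he p).trans ?_
    rw [Nat.factorization_one, Finsupp.zero_apply, Nat.modEq_zero_iff_dvd]
    exact Finset.dvd_sum fun i _ => (hdvd i).mul_right _
  · push Not at hdvd
    exact hbad ⟨e, b, hbk, hbA, hdvd, he⟩

open Classical in
-- `rootField k` is injective on non-exceptional sets. Erasing `1`, whose root is rational, leaves
-- it free to play the role of `b` when encoding dependence, and only replaces `q` by `q - 1`.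
theorem choose_le_maxDegreeCount_add {k H : ℕ} (hk : 0 < k) (hH : 1 ≤ H) (n : ℕ) :
    ((powerFree k H).card - 1).choose n ≤ maxDegreeCount k n H +
      {A ∈ Finset.powersetCard n ((powerFree k H).erase 1) | HasExtraRadical k H A}.card := by
  rw [← Finset.card_erase_of_mem (one_mem_powerFree hk hH), ← Finset.card_powersetCard,
    ← Finset.card_filter_add_card_filter_not (HasExtraRadical k H), add_comm]
  refine Nat.add_le_add_right ?_ _
  rw [maxDegreeCount, ← Set.ncard_coe_finset]
  refine Set.ncard_le_ncard_of_injOn (rootField k) ?_ ?_ (maxDegreeFields_finite k n H)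
  · intro A hA
    rw [Finset.mem_coe, Finset.mem_filter, Finset.mem_powersetCard] at hA
    obtain ⟨⟨hsub, hcard⟩, hbad⟩ := hA
    set ψ := (A.equivFinOfCardEq hcard).symm with hψ
    refine ⟨fun i => ψ i, fun i => (mem_powerFree.1 (Finset.mem_of_mem_erase (hsub (ψ i).2))).1,
      ?_, ?_⟩
    · rw [radicalField_eq_rootField]
      congr 1
      ext m
      simp only [Finset.mem_image, Finset.mem_univ, true_and]
      constructor
      · rintro ⟨i, rfl⟩
        exact (ψ i).2
      · intro hm
        exact ⟨ψ.symm ⟨m, hm⟩, by simp⟩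
    · rw [finrank_rootField hk hH hsub hbad, hcard]
  · intro A hA B hB hAB
    rw [Finset.mem_coe, Finset.mem_filter, Finset.mem_powersetCard] at hA hB
    exact Finset.Subset.antisymm
      (subset_of_rootField_eq hk hH hB.1.1 hB.2 hA.1.1 hAB.symm)
      (subset_of_rootField_eq hk hH hA.1.1 hA.2 hB.1.1 hAB)

/-! ### Exceptional sets are rare -/

/-- The possible nonzero vectors of `p`-adic valuations of `(a₁, …, aₙ, b)`, where all entries are
`k`-th power free and `b = ∏ aᵢ ^ eᵢ` modulo `k`-th powers. -/
def relationVectors (k n : ℕ) (e : Fin n → Fin k) : Finset (Option (Fin n) → ℕ) :=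
  {v ∈ Fintype.piFinset fun _ => Finset.range k | v ≠ 0 ∧
    v none ≡ ∑ i, (e i : ℕ) * v (some i) [MOD k]}

/-- With total valuation one, the relation would read `1 ≡ 0` or `0 ≡ e i` modulo `k`; the latter
forces `e i = 0`, which `hsupp` excludes. -/
theorem two_le_sum_of_mem_relationVectors {k n : ℕ} {e : Fin n → Fin k}
    {v : Option (Fin n) → ℕ} (hv : v ∈ relationVectors k n e)
    (hsupp : ∀ i, (e i : ℕ) = 0 → v (some i) = 0) : 2 ≤ v none + ∑ i, v (some i) := by
  simp only [relationVectors, Finset.mem_filter, Fintype.mem_piFinset, Finset.mem_range] at hv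
  obtain ⟨hlt, hne, hmod⟩ := hv
  by_cases hall : ∀ i, v (some i) = 0
  · exfalso
    simp only [hall, mul_zero, Finset.sum_const_zero] at hmod
    have h0 : v none = 0 := hmod.eq_of_lt_of_lt (hlt none) ((Nat.zero_le _).trans_lt (hlt none))
    apply hne
    funext o
    cases o with
    | none => exact h0
    | some i => exact hall i
  · push Not at hall
    obtain ⟨i, hi⟩ := hall
    have hsum := Finset.add_sum_erase Finset.univ (fun i => v (some i)) (Finset.mem_univ i)
    by_contra! hcon
    have hvi : v (some i) = 1 := by omega
    have hnone : v none = 0 := by omega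
    have hrest : ∑ j ∈ Finset.univ.erase i, v (some j) = 0 := by omega
    rw [Finset.sum_eq_zero_iff] at hrest
    rw [Finset.sum_eq_single i (fun j _ hj => by
      rw [hrest j (Finset.mem_erase.2 ⟨hj, Finset.mem_univ j⟩), mul_zero]) (by simp), hvi, hnone,
      mul_one] at hmod
    have he : 0 = (e i : ℕ) :=
      hmod.eq_of_lt_of_lt ((Nat.zero_le _).trans_lt (e i).2) (e i).2
    exact hi (hsupp i he.symm)

/-- For a relation `b = a ^ e` modulo `k`-th powers with `e ≠ 0, 1`, total valuation two would mean
`2 ≡ 0`, `1 ≡ e` or `0 ≡ 2 * e` modulo `k`. The last is impossible because `k` is odd. -/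
theorem three_le_sum_of_mem_relationVectors {k n : ℕ} (hk : 3 ≤ k) (hodd : Odd k)
    {e : Fin n → Fin k} {j : Fin n} (hj : ∀ i, i ≠ j → (e i : ℕ) = 0) (hj0 : (e j : ℕ) ≠ 0)
    (hj1 : (e j : ℕ) ≠ 1) {v : Option (Fin n) → ℕ} (hv : v ∈ relationVectors k n e)
    (hsupp : ∀ i, (e i : ℕ) = 0 → v (some i) = 0) : 3 ≤ v none + ∑ i, v (some i) := by
  have h2 := two_le_sum_of_mem_relationVectors hv hsupp
  simp only [relationVectors, Finset.mem_filter, Fintype.mem_piFinset, Finset.mem_range] at hv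
  obtain ⟨hlt, hne, hmod⟩ := hv
  have hzero : ∀ i, i ≠ j → v (some i) = 0 := fun i hi => hsupp i (hj i hi)
  rw [Finset.sum_eq_single j (fun i _ hi => hzero i hi) (by simp)] at h2 ⊢
  rw [Finset.sum_eq_single j (fun i _ hi => by rw [hzero i hi, mul_zero]) (by simp)] at hmod
  by_contra! hcon
  have hej := (e j).2
  have hcases : v (some j) = 0 ∧ v none = 2 ∨ v (some j) = 1 ∧ v none = 1 ∨
      v (some j) = 2 ∧ v none = 0 := by omega
  rcases hcases with ⟨ha, hb⟩ | ⟨ha, hb⟩ | ⟨ha, hb⟩ <;> rw [ha, hb] at hmod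
  · have := hmod.eq_of_lt_of_lt (by omega) (by omega)
    omega
  · rw [mul_one] at hmod
    exact hj1 (hmod.eq_of_lt_of_lt (by omega) hej).symm
  · have hdvd : k ∣ (e j : ℕ) * 2 := (Nat.modEq_zero_iff_dvd).1 hmod.symm
    have hcop : Nat.Coprime k 2 := Nat.coprime_two_right.2 hodd
    have := Nat.le_of_dvd (by omega) (hcop.dvd_of_dvd_mul_right hdvd)
    omega

/-- Variables absent from the relation get weight `1 + δ`, so any prime dividing one of them is
harmless. At other primes the total valuation is at least `2`, or `3` when one variable occurs, so
weights `3/5` or `2/5` on `b` and the occurring variables suffice, as `2 * 3/5` and `3 * 2/5` exceed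
`1`. Either choice brings the total to at most `n - 1/5 + n * δ`, and `δ = 1 / (10 * n)` gives the
claim. -/
theorem exists_weights {k n : ℕ} (hk : 3 ≤ k) (hodd : Odd k) (hn : 1 ≤ n) {e : Fin n → Fin k}
    (he0 : ∃ i, (e i : ℕ) ≠ 0) (he1 : ∀ j, (e j : ℕ) = 1 → ∃ i, i ≠ j ∧ (e i : ℕ) ≠ 0) :
    ∃ σ : Option (Fin n) → ℝ, (∀ o, 0 ≤ σ o) ∧
      (∀ v ∈ relationVectors k n e, 1 < ∑ o, σ o * v o) ∧ ∑ o, σ o ≤ n - 1 / 10 := by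
  set T : Finset (Fin n) := {i | (e i : ℕ) ≠ 0} with hT
  set s : ℝ := if T.card = 1 then 2 / 5 else 3 / 5 with hs
  set δ : ℝ := 1 / (10 * n) with hδ
  have hn' : (0 : ℝ) < n := by exact_mod_cast hn
  have hδ0 : 0 < δ := by positivity
  have hs0 : 0 < s := by rw [hs]; split_ifs <;> norm_num
  have hTpos : 1 ≤ T.card := by
    obtain ⟨i, hi⟩ := he0
    exact Finset.card_pos.2 ⟨i, by simpa [hT] using hi⟩
  have hTn : T.card ≤ n := by simpa using T.card_le_univ
  let σ : Option (Fin n) → ℝ := fun o => o.elim s fun i => if (e i : ℕ) ≠ 0 then s else 1 + δ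
  have hσ0 : ∀ o, 0 ≤ σ o := by
    intro o
    cases o with
    | none => exact hs0.le
    | some i =>
      change 0 ≤ if (e i : ℕ) ≠ 0 then s else 1 + δ
      split_ifs <;> positivity
  refine ⟨σ, hσ0, fun v hv => ?_, ?_⟩
  · by_cases hsupp : ∀ i, (e i : ℕ) = 0 → v (some i) = 0
    · have hsum : ∑ o, σ o * v o = s * ((v none + ∑ i, v (some i) : ℕ) : ℝ) := by
        rw [Fintype.sum_option]
        push_cast
        rw [mul_add, Finset.mul_sum]
        congr 1
        refine Finset.sum_congr rfl fun i _ => ?_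
        by_cases hi : (e i : ℕ) = 0
        · simp [hsupp i hi]
        · simp [σ, hi]
      rw [hsum]
      by_cases hcard : T.card = 1
      · obtain ⟨j, hj⟩ := Finset.card_eq_one.1 hcard
        have hmem : ∀ i, (e i : ℕ) ≠ 0 ↔ i = j := by
          intro i
          have : i ∈ T ↔ i = j := by rw [hj, Finset.mem_singleton]
          simpa [hT] using this
        have h3 := three_le_sum_of_mem_relationVectors hk hodd (j := j)
          (fun i hi => by by_contra h; exact hi ((hmem i).1 h)) ((hmem j).2 rfl)
          (fun h1 => by
            obtain ⟨i, hij, hi⟩ := he1 j h1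
            exact hij ((hmem i).1 hi)) hv hsupp
        have h3' : (3 : ℝ) ≤ ((v none + ∑ i, v (some i) : ℕ) : ℝ) := by exact_mod_cast h3
        rw [hs, if_pos hcard]
        linarith
      · have h2 := two_le_sum_of_mem_relationVectors hv hsupp
        have h2' : (2 : ℝ) ≤ ((v none + ∑ i, v (some i) : ℕ) : ℝ) := by exact_mod_cast h2
        rw [hs, if_neg hcard]
        linarith
    · push Not at hsupp
      obtain ⟨i, hi, hvi⟩ := hsupp
      have h1 : σ (some i) * v (some i) ≤ ∑ o, σ o * v o :=
        Finset.single_le_sum (f := fun o => σ o * (v o : ℝ))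
          (fun o _ => mul_nonneg (hσ0 o) (Nat.cast_nonneg _)) (Finset.mem_univ _)
      refine lt_of_lt_of_le ?_ h1
      have h2 : σ (some i) = 1 + δ := by simp [σ, hi]
      have h3 : (1 : ℝ) ≤ v (some i) := by exact_mod_cast Nat.one_le_iff_ne_zero.2 hvi
      rw [h2]
      nlinarith
  · have hsum : ∑ o, σ o = s + (T.card * s + ((n : ℝ) - T.card) * (1 + δ)) := by
      rw [Fintype.sum_option]
      congr 1
      have h1 : ∑ i, σ (some i) = ∑ i, if (e i : ℕ) ≠ 0 then s else 1 + δ := rfl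
      have h2 := Finset.card_filter_add_card_filter_not (s := (Finset.univ : Finset (Fin n)))
        (fun i => (e i : ℕ) ≠ 0)
      have h3 : ((Finset.univ.filter fun i : Fin n => ¬ (e i : ℕ) ≠ 0).card : ℝ) =
          (n : ℝ) - T.card := by
        rw [Finset.card_univ, Fintype.card_fin] at h2
        rw [eq_sub_iff_add_eq']
        exact_mod_cast h2
      rw [h1, Finset.sum_ite, Finset.sum_const, Finset.sum_const, nsmul_eq_mul, nsmul_eq_mul, h3]
    rw [hsum]
    have hTn' : (T.card : ℝ) ≤ n := by exact_mod_cast hTn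
    have hnδ : (n : ℝ) * δ = 1 / 10 := by
      rw [hδ]
      field_simp
    have hTδ : 0 ≤ (T.card : ℝ) * δ := by positivity
    by_cases hcard : T.card = 1
    · rw [hs, if_pos hcard, hcard] at *
      push_cast at *
      linarith
    · have h2 : (2 : ℝ) ≤ T.card := by
        have : 2 ≤ T.card := by omega
        exact_mod_cast this
      rw [hs, if_neg hcard]
      linarith

open Classical in
theorem exists_card_hasExtraRadical_le {k n : ℕ} (hk : 3 ≤ k) (hodd : Odd k) (hn : 1 ≤ n) :
    ∃ C : ℝ, ∀ H : ℕ, 1 ≤ H →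
      ({A ∈ Finset.powersetCard n ((powerFree k H).erase 1) | HasExtraRadical k H A}.card : ℝ) ≤
        C * (H : ℝ) ^ ((n : ℝ) - 1 / 10) := by
  -- Exponent vectors modulo `k` that are neither zero nor a unit vector; a unit vector would force
  -- `b` to be one of the `aᵢ`, hence in `A`.
  set E : Finset (Fin n → Fin k) := {e | (∃ i, (e i : ℕ) ≠ 0) ∧
    ∀ j, (e j : ℕ) = 1 → ∃ i, i ≠ j ∧ (e i : ℕ) ≠ 0} with hE
  let S : ℕ → (Fin n → Fin k) → Finset (Option (Fin n) → ℕ) := fun H e =>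
    {f ∈ Fintype.piFinset fun _ => Finset.Icc 1 H |
      ∀ p : ℕ, (fun o => (f o).factorization p) ∈ insert 0 (relationVectors k n e)}
  have hS : ∀ e ∈ E, ∃ C : ℝ, ∀ H : ℕ, 1 ≤ H →
      ((S H e).card : ℝ) ≤ C * (H : ℝ) ^ ((n : ℝ) - 1 / 10) := by
    intro e he
    obtain ⟨he0, he1⟩ := (Finset.mem_filter.1 he).2
    obtain ⟨σ, hσ0, hσV, hσsum⟩ := exists_weights hk hodd hn he0 he1
    obtain ⟨C, hC⟩ := exists_card_factorization_mem_le σ hσ0 _ hσV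
    refine ⟨|C|, fun H hH => ?_⟩
    have hH' : (1 : ℝ) ≤ H := by exact_mod_cast hH
    calc ((S H e).card : ℝ) ≤ C * (H : ℝ) ^ ∑ o, σ o := by
          refine hC H _ fun f hf => ?_
          rw [Finset.mem_filter, Fintype.mem_piFinset] at hf
          exact ⟨fun i => Finset.mem_Icc.1 (hf.1 i), hf.2⟩
      _ ≤ |C| * (H : ℝ) ^ ((n : ℝ) - 1 / 10) := by
          gcongr
          exact le_abs_self C
  choose! C hC using hS
  refine ⟨∑ e ∈ E, C e, fun H hH => ?_⟩
  have hsub : {A ∈ Finset.powersetCard n ((powerFree k H).erase 1) | HasExtraRadical k H A} ⊆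
      E.biUnion fun e => (S H e).image fun f => Finset.univ.image fun i => f (some i) := by
    intro A hA
    rw [Finset.mem_filter, Finset.mem_powersetCard] at hA
    obtain ⟨⟨hAsub, hcard⟩, e, b, hb, hbA, ⟨i₀, hi₀⟩, hmod⟩ := hA
    have hApf : ∀ m : A, (m : ℕ) ∈ powerFree k H := fun m => Finset.mem_of_mem_erase (hAsub m.2)
    set ψ := (A.equivFinOfCardEq hcard).symm with hψ
    have hk0 : 0 < k := by omega
    set e' : Fin n → Fin k := fun i => ⟨e (ψ i) % k, Nat.mod_lt _ hk0⟩ with he'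
    set f : Option (Fin n) → ℕ := fun o => o.elim b fun i => (ψ i : ℕ) with hf
    have hfpf : ∀ o, f o ∈ powerFree k H := by
      intro o
      cases o with
      | none => exact hb
      | some i => exact hApf (ψ i)
    have hmod' : ∀ p, b.factorization p ≡
        ∑ i, (e' i : ℕ) * (ψ i : ℕ).factorization p [MOD k] := by
      intro p
      refine (hmod p).trans ?_
      rw [← Equiv.sum_comp ψ]
      exact Nat.ModEq.sum fun i _ => (Nat.mod_modEq _ _).symm.mul_right _
    have he'E : e' ∈ E := by
      refine Finset.mem_filter.2 ⟨Finset.mem_univ _, ⟨ψ.symm i₀, ?_⟩, fun j hj => ?_⟩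
      · simpa [he', Nat.dvd_iff_mod_eq_zero] using hi₀
      · by_contra! hcon
        refine hbA ?_
        have hbj : b = (ψ j : ℕ) := by
          refine eq_of_factorization_modEq hk0 hb (hApf (ψ j)) fun p => ?_
          have := hmod' p
          rwa [Finset.sum_eq_single j (fun i _ hi => by rw [hcon i hi, zero_mul]) (by simp), hj,
            one_mul] at this
        rw [hbj]
        exact (ψ j).2
    rw [Finset.mem_biUnion]
    refine ⟨e', he'E, Finset.mem_image.2 ⟨f, ?_, ?_⟩⟩
    · refine Finset.mem_filter.2 ⟨?_, fun p => ?_⟩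
      · exact Fintype.mem_piFinset.2 fun o => Finset.mem_Icc.2 (mem_powerFree.1 (hfpf o)).1
      · rw [Finset.mem_insert]
        refine or_iff_not_imp_left.2 fun hne => ?_
        refine Finset.mem_filter.2 ⟨Fintype.mem_piFinset.2 fun o => Finset.mem_range.2 ?_, hne, ?_⟩
        · exact factorization_lt_of_floorRoot_eq_one hk0 (mem_powerFree.1 (hfpf o)).2 p
        · exact hmod' p
    · ext m
      simp only [Finset.mem_image, Finset.mem_univ, true_and]
      constructor
      · rintro ⟨i, rfl⟩
        exact (ψ i).2
      · intro hm
        exact ⟨ψ.symm ⟨m, hm⟩, by simp [hf]⟩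
  calc _ ≤ ((∑ e ∈ E, (S H e).card : ℕ) : ℝ) := by
        exact_mod_cast (Finset.card_le_card hsub).trans
          (Finset.card_biUnion_le.trans (Finset.sum_le_sum fun e _ => Finset.card_image_le))
    _ ≤ ∑ e ∈ E, C e * (H : ℝ) ^ ((n : ℝ) - 1 / 10) := by
        push_cast
        exact Finset.sum_le_sum fun e he => hC e he H hH
    _ = _ := by rw [Finset.sum_mul]

/-! ### The asymptotic formula -/

theorem exists_abs_maxDegreeCount_sub_le {k n : ℕ} (hk : 3 ≤ k) (hodd : Odd k) (hn : 1 ≤ n) :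
    ∃ C : ℝ, ∀ H : ℕ, 1 ≤ H →
      |(maxDegreeCount k n H : ℝ) - (powerFreeDensity k * H) ^ n / n !| ≤
        C * (H : ℝ) ^ ((n : ℝ) - 1 / 10) := by
  classical
  obtain ⟨C₁, h₁⟩ := exists_abs_card_powerFree_sub_le hk
  obtain ⟨C₂, h₂⟩ := exists_abs_choose_sub_le (powerFreeDensity k) (C₁ + 1) n
  obtain ⟨C₃, h₃⟩ := exists_card_hasExtraRadical_le (n := n) hk hodd hn
  refine ⟨|C₂| + |C₃|, fun H hH => ?_⟩
  have hH' : (1 : ℝ) ≤ H := by exact_mod_cast hH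
  have hs1 : 1 ≤ Real.sqrt H := Real.one_le_sqrt.2 hH'
  -- Applied both to the number of power free integers and to that number minus one; the constant
  -- `C₁ + 1` absorbs the shift.
  have hchoose : ∀ q : ℕ, q ≤ H → |(q : ℝ) - powerFreeDensity k * H| ≤ (C₁ + 1) * Real.sqrt H →
      |(q.choose n : ℝ) - (powerFreeDensity k * H) ^ n / n !| ≤
        |C₂| * (H : ℝ) ^ ((n : ℝ) - 1 / 10) := by
    intro q hq hqc
    have h := h₂ H q hH hq hqc
    rw [← le_div_iff₀ (by positivity)] at h
    refine h.trans ?_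
    rw [mul_div_assoc]
    have h4 : (H : ℝ) ^ n / Real.sqrt H ≤ (H : ℝ) ^ ((n : ℝ) - 1 / 10) := by
      rw [Real.sqrt_eq_rpow, ← Real.rpow_natCast, ← Real.rpow_sub (by positivity)]
      exact Real.rpow_le_rpow_of_exponent_le hH' (by linarith)
    exact mul_le_mul (le_abs_self _) h4 (by positivity) (abs_nonneg _)
  have hq := h₁ H
  have hq1 : 1 ≤ (powerFree k H).card :=
    Finset.card_pos.2 ⟨1, one_mem_powerFree (by omega) hH⟩
  have hup := hchoose _ (card_powerFree_le k H) (hq.trans (by nlinarith))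
  have hlow := hchoose ((powerFree k H).card - 1)
    ((Nat.sub_le _ _).trans (card_powerFree_le k H)) (by
      rw [Nat.cast_sub hq1, Nat.cast_one, sub_right_comm]
      have := abs_sub (((powerFree k H).card : ℝ) - powerFreeDensity k * H) 1
      rw [abs_one] at this
      linarith)
  have hcount_up : (maxDegreeCount k n H : ℝ) ≤ ((powerFree k H).card.choose n : ℝ) := by
    exact_mod_cast maxDegreeCount_le (by omega) n H
  have hcount_low : (((powerFree k H).card - 1).choose n : ℝ) ≤ (maxDegreeCount k n H : ℝ) +
      ({A ∈ Finset.powersetCard n ((powerFree k H).erase 1) | HasExtraRadical k H A}.card : ℝ) := by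
    exact_mod_cast choose_le_maxDegreeCount_add (by omega) hH n
  have hbad := h₃ H hH
  have hX : 0 ≤ (H : ℝ) ^ ((n : ℝ) - 1 / 10) := by positivity
  have hC₃ : C₃ * (H : ℝ) ^ ((n : ℝ) - 1 / 10) ≤ |C₃| * (H : ℝ) ^ ((n : ℝ) - 1 / 10) :=
    mul_le_mul_of_nonneg_right (le_abs_self _) hX
  have hC₃' : 0 ≤ |C₃| * (H : ℝ) ^ ((n : ℝ) - 1 / 10) := by positivity
  rw [abs_le] at hup hlow ⊢
  rw [add_mul]
  constructor
  · linarith [hlow.1]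
  · linarith [hup.2]

theorem eventually_rpow_le_exp_sqrt :
    ∀ᶠ H : ℕ in atTop, (H : ℝ) ^ (-(1 / 10) : ℝ) ≤
      Real.exp (-Real.sqrt (Real.log (H : ℝ) * Real.log (Real.log (H : ℝ)) / 2)) := by
  have hlog : Tendsto (fun H : ℕ => Real.log (H : ℝ)) atTop atTop :=
    Real.tendsto_log_atTop.comp tendsto_natCast_atTop_atTop
  -- The constant `50` is what makes `L * log L / 2 ≤ (L / 10) ^ 2`.
  have hsmall : ∀ᶠ L : ℝ in atTop, Real.log L ≤ L / 50 := by
    have h := Real.isLittleO_log_id_atTop.bound (show (0 : ℝ) < 1 / 50 by norm_num)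
    filter_upwards [h, eventually_ge_atTop 0] with L hL hL0
    rw [Real.norm_eq_abs, id, Real.norm_eq_abs, abs_of_nonneg hL0] at hL
    linarith [le_abs_self (Real.log L)]
  filter_upwards [hlog.eventually hsmall, hlog.eventually (eventually_ge_atTop 0),
    eventually_ge_atTop 1] with H hH hL hH1
  have hpos : (0 : ℝ) < H := by exact_mod_cast hH1
  rw [Real.rpow_def_of_pos hpos, Real.exp_le_exp]
  have hsq : Real.sqrt (Real.log (H : ℝ) * Real.log (Real.log (H : ℝ)) / 2) ≤
      Real.log H / 10 := by
    rw [Real.sqrt_le_left (by positivity)]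
    nlinarith [mul_le_mul_of_nonneg_left hH hL]
  linarith

theorem theorem3p4 (k n : ℕ) (hk : 3 ≤ k) (hk_odd : Odd k) (hn : 1 ≤ n) :
    ∃ ε : ℕ → ℝ, Tendsto ε atTop (𝓝 0) ∧
      (fun H : ℕ =>
          (maxDegreeCount k n H : ℂ)
            - 1 / ((n ! : ℂ) * riemannZeta (k : ℂ) ^ n) * (H : ℂ) ^ n)
        =O[atTop]
      (fun H : ℕ =>
          Real.exp (-(1 + ε H) *
            Real.sqrt (Real.log (H : ℝ) * Real.log (Real.log (H : ℝ)) / 2)) * (H : ℝ) ^ n) := by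
  obtain ⟨C, hC⟩ := exists_abs_maxDegreeCount_sub_le hk hk_odd hn
  -- Because the error saves the power `H ^ (1/10)`, the `o(1)` term can be taken to be zero.
  refine ⟨fun _ => 0, tendsto_const_nhds, IsBigO.of_bound |C| ?_⟩
  filter_upwards [eventually_rpow_le_exp_sqrt, eventually_ge_atTop 1] with H hexp hH
  have hpos : (0 : ℝ) < H := by exact_mod_cast hH
  have hcast : (maxDegreeCount k n H : ℂ)
      - 1 / ((n ! : ℂ) * riemannZeta (k : ℂ) ^ n) * (H : ℂ) ^ n =
      (((maxDegreeCount k n H : ℝ) - (powerFreeDensity k * H) ^ n / n ! : ℝ) : ℂ) := by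
    push_cast
    rw [powerFreeDensity_eq (by omega)]
    ring
  rw [hcast, Complex.norm_real, Real.norm_eq_abs, Real.norm_of_nonneg (by positivity), add_zero,
    neg_one_mul]
  refine (hC H hH).trans ?_
  rw [sub_eq_neg_add, Real.rpow_add hpos, Real.rpow_natCast]
  gcongr
  exact le_abs_self C
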